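/- **Setting.** Let $d$ be a natural number and let $\theta\in(\mathbf R\setminus\{0\})^d$. Set $$\Lambda=\{(\theta_1n_1,\dots,\theta_dn_d)\,:\,(n_1,\dots,n_d)\in\mathbf Z^d\}\subseteq\mathbf R^d .$$ A *weight* on $\mathbf R^n$ is a function $\omega:\mathbf R^n\to(0,\infty)$ such that $\omega$ and $1/\omega$ belong to $L^\infty_{loc}(\mathbf R^n)$. For a weight $\omega$ on $\mathbf R^d$, $\ell^2_{(\omega)}(\Lambda)$ is the Hilbert space of all $f:\Lambda\to\mathbf C$ such that $\|f\|_{\ell^2_{(\omega)}}=\big(\sum_{k\in\Lambda}|f(k)\omega(k)|^2\big)^{1/2}<\infty$. For a weight $\omega$ on $\mathbf R^{2d}$ and $0<p<\infty$, $\mathbb U^p(\omega,\Lambda)$ is the set of all complex matrices $A=(a(j,k))_{j,k\in\Lambda}$ such that $$\|A\|_{\mathbb U^p(\omega,\Lambda)}=\Big(\sum_{k\in\Lambda}\sum_{j\in\Lambda}|a(j,j-k)\,\omega(j,j-k)|^p\Big)^{1/p}<\infty .$$ For a bounded linear operator $T$ between Hilbert spaces $\mathscr H_1$ and $\mathscr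 H_2$ and an integer $j\ge1$, let $\sigma_j(T)$ be the infimum of the operator norms $\|T-T_0\|$ over all bounded linear operators $T_0:\mathscr H_1\to\mathscr H_2$ of rank at most $j-1$. The Schatten class $\mathscr I_p(\mathscr H_1,\mathscr H_2)$ consists of all such $T$ with $\|T\|_{\mathscr I_p}=\big(\sum_{j\ge1}\sigma_j(T)^p\big)^{1/p}<\infty$. **Theorem 2.5.** Let $\omega_1,\omega_2$ be weights on $\mathbf R^d$ and let $\omega_0$ be a weight on $\mathbf R^{2d}$ such that $$\frac{\omega_2(j)}{\omega_1(k)}\le\omega_0(j,k),\qquad j,k\in\Lambda .$$ Let $p\in(0,2]$ and let $A=(a(j,k))_{j,k\in\Lambda}\in\mathbb U^p(\omega_0,\Lambda)$. Then the map $f\mapsto Af$, $(Af)(j)=\sum_{k\in\Lambda}a(j,k)f(k)$, defined for finitely supported $f:\Lambda\to\mathbf C$, has a unique extension to a bounded linear operator from $\ell^2_{(\omega_1)}(\Lambda)$ to $\ell^2_{(\omega_2)}(\Lambda)$. This extension, again denoted by $A$, belongs to $\mathscr I_p(\ell^2_{(\omega_1)}(\Lambda),\ell^2_{(\omega_2)}(\Lambda))$,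 and $$\|A\|_{\mathscr I_p(\ell^2_{(\omega_1)}(\Lambda),\ell^2_{(\omega_2)}(\Lambda))}\le\|A\|_{\mathbb U^p(\omega_0,\Lambda)} .$$ -/

import Mathlib

open scoped ENNReal
open MeasureTheory

noncomputable section

namespace MatrixSchatten

/-- The Euclidean space `ℝ^d`. -/
abbrev Euc (d : ℕ) : Type := EuclideanSpace ℝ (Fin d)

/-- A weight on `X` (here `X` is `ℝ^d`, or `ℝ^{2d} = ℝ^d × ℝ^d`): an everywhere positive function
`ω` such that both `ω` and `1 / ω` belong to `L^∞_loc`. -/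
structure Weight (X : Type*) [TopologicalSpace X] [MeasureSpace X] where
  /-- the underlying function -/
  toFun : X → ℝ
  pos : ∀ x, 0 < toFun x
  memLp_loc : ∀ K : Set X, IsCompact K → MemLp toFun ∞ (volume.restrict K)
  inv_memLp_loc : ∀ K : Set X, IsCompact K → MemLp (fun x => (toFun x)⁻¹) ∞ (volume.restrict K)

instance {X : Type*} [TopologicalSpace X] [MeasureSpace X] :
    CoeFun (Weight X) (fun _ => X → ℝ) := ⟨Weight.toFun⟩

/-- The lattice `T_θ ℤ^d = {(θ_1 n_1, …, θ_d n_d) : n ∈ ℤ^d}` in `ℝ^d`. -/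
def lattice {d : ℕ} (θ : Fin d → ℝ) : AddSubgroup (Euc d) where
  carrier := Set.range fun n : Fin d → ℤ => WithLp.toLp 2 (fun i => θ i * (n i : ℝ))
  zero_mem' := ⟨0, by ext i; simp⟩
  add_mem' := by
    rintro _ _ ⟨m, rfl⟩ ⟨n, rfl⟩
    exact ⟨m + n, by ext i; simp [mul_add]⟩
  neg_mem' := by
    rintro _ ⟨m, rfl⟩
    exact ⟨-m, by ext i; simp⟩

/-! ### Sequence quasi-norms and the matrix classes -/

/-- The `ℓ^p` quasi-norm, `0 < p ≤ ∞`, of a family of extended non-negative numbers. -/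
def ellNorm {ι : Type*} (p : ℝ≥0∞) (f : ι → ℝ≥0∞) : ℝ≥0∞ :=
  if p = ∞ then ⨆ i, f i else (∑' i, f i ^ p.toReal) ^ (1 / p.toReal)

section Matrices

variable {G : Type*} [AddCommGroup G]

/-- `H_{A,ω}(j,k) = a(j,j-k) ω(j,j-k)`. -/
def bigH (ω : G → G → ℝ) (A : Matrix G G ℂ) (j k : G) : ℂ :=
  A j (j - k) * (ω j (j - k) : ℂ)

/-- `h_{A,p,ω}(k) = ‖H_{A,ω}(·,k)‖_{ℓ^p}`. -/
def smallH (p : ℝ≥0∞) (ω : G → G → ℝ) (A : Matrix G G ℂ) (k : G) : ℝ≥0∞ :=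
  ellNorm p fun j => ‖bigH ω A j k‖ₑ

/-- The quasi-norm `‖A‖_{U^{p,q}(ω)} = ‖h_{A,p,ω}‖_{ℓ^q}`. -/
def matrixNorm (p q : ℝ≥0∞) (ω : G → G → ℝ) (A : Matrix G G ℂ) : ℝ≥0∞ :=
  ellNorm q (smallH p ω A)

/-- The class `U^{p,q}(ω)` of matrices. -/
def matrixClass (p q : ℝ≥0∞) (ω : G → G → ℝ) : Set (Matrix G G ℂ) :=
  {A | matrixNorm p q ω A < ∞}

end Matrices

/-! ### Weighted `ℓ²` spaces -/

section WeightedL2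

variable {d : ℕ} (Λ : AddSubgroup (Euc d)) (ω : Weight (Euc d))

/-- The sequences `f` on `Λ` with `f · ω ∈ ℓ²(Λ)`, as a subspace of all sequences. -/
def weightedL2Submodule : Submodule ℂ (Λ → ℂ) where
  carrier := {f | Memℓp (fun k : Λ => f k * (ω k : ℂ)) 2}
  zero_mem' := by
    have : (fun k : Λ => (0 : Λ → ℂ) k * (ω k : ℂ)) = 0 := by ext; simp
    simpa only [Set.mem_ofPred_eq, this] using zero_memℓp
  add_mem' := by
    intro f g hf hg
    have : (fun k : Λ => (f + g) k * (ω k : ℂ))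
        = (fun k : Λ => f k * (ω k : ℂ)) + fun k : Λ => g k * (ω k : ℂ) := by
      ext; simp [add_mul]
    simpa only [Set.mem_ofPred_eq, this] using hf.add hg
  smul_mem' := by
    intro c f hf
    have : (fun k : Λ => (c • f) k * (ω k : ℂ)) = c • fun k : Λ => f k * (ω k : ℂ) := by
      ext; simp [mul_assoc]
    simpa only [Set.mem_ofPred_eq, this] using hf.const_smul c

/-- The Hilbert space `ℓ²_{(ω)}(Λ)`; its norm is `‖f‖ = ‖f · ω‖_{ℓ²(Λ)}`. -/
def WeightedL2 : Type := ↥(weightedL2Submodule Λ ω)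

namespace WeightedL2

instance : AddCommGroup (WeightedL2 Λ ω) := inferInstanceAs (AddCommGroup ↥(weightedL2Submodule Λ ω))

instance : Module ℂ (WeightedL2 Λ ω) := inferInstanceAs (Module ℂ ↥(weightedL2Submodule Λ ω))

instance : CoeFun (WeightedL2 Λ ω) (fun _ => Λ → ℂ) := ⟨fun f => f.1⟩

/-- The map `f ↦ f · ω` from `ℓ²_{(ω)}(Λ)` to `ℓ²(Λ)`. -/
def toL2 : WeightedL2 Λ ω →ₗ[ℂ] lp (fun _ : Λ => ℂ) 2 where
  toFun f := ⟨fun k => f k * (ω k : ℂ), f.2⟩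
  map_add' f g := by
    ext k
    exact add_mul (f k) (g k) _
  map_smul' c f := by
    ext k
    exact mul_assoc c (f k) _

theorem toL2_injective : Function.Injective (toL2 Λ ω) := by
  intro f g h
  apply Subtype.ext
  funext k
  have hk : f k * (ω k : ℂ) = g k * (ω k : ℂ) := congrFun (congrArg Subtype.val h) k
  exact mul_right_cancel₀ (Complex.ofReal_ne_zero.2 (ω.pos k).ne') hk

theorem toL2_surjective : Function.Surjective (toL2 Λ ω) := by
  intro g
  have h : (fun k : Λ => g k / (ω k : ℂ) * (ω k : ℂ)) = g := by
    funext k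
    exact div_mul_cancel₀ _ (Complex.ofReal_ne_zero.2 (ω.pos k).ne')
  refine ⟨⟨fun k => g k / (ω k : ℂ), ?_⟩, ?_⟩
  · change Memℓp (fun k : Λ => g k / (ω k : ℂ) * (ω k : ℂ)) 2
    rw [h]
    exact g.2
  · exact Subtype.ext h

instance : NormedAddCommGroup (WeightedL2 Λ ω) :=
  NormedAddCommGroup.induced _ _ (toL2 Λ ω) (toL2_injective Λ ω)

/-- The inner product is `(f, g) = ∑ conj (f k) (g k) ω(k)²`. -/
instance : InnerProductSpace ℂ (WeightedL2 Λ ω) where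
  norm_smul_le c f := by
    change ‖toL2 Λ ω (c • f)‖ ≤ ‖c‖ * ‖toL2 Λ ω f‖
    rw [map_smul, norm_smul]
  inner f g := inner ℂ (toL2 Λ ω f) (toL2 Λ ω g)
  norm_sq_eq_re_inner f := norm_sq_eq_re_inner (𝕜 := ℂ) (toL2 Λ ω f)
  conj_inner_symm f g := inner_conj_symm (toL2 Λ ω f) (toL2 Λ ω g)
  add_left f g h := by
    rw [map_add, inner_add_left]
  smul_left f g c := by
    rw [map_smul, inner_smul_left]

instance : CompleteSpace (WeightedL2 Λ ω) := by
  have hi : Isometry (toL2 Λ ω) := AddMonoidHomClass.isometry_of_norm _ fun _ => rfl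
  exact (IsometryEquiv.mk (Equiv.ofBijective _ ⟨toL2_injective Λ ω, toL2_surjective Λ ω⟩)
    hi).completeSpace

end WeightedL2

variable {Λ} {ω} {ω' : Weight (Euc d)}

/-- `T` extends the matrix map `A : ℓ_0(Λ) → ℓ(Λ)`, `(A f)(j) = ∑_k a(j,k) f(k)`, where `ℓ_0(Λ)`
is the space of finitely supported sequences. -/
def Extends (A : Matrix Λ Λ ℂ) (T : WeightedL2 Λ ω →L[ℂ] WeightedL2 Λ ω') : Prop :=
  ∀ f : WeightedL2 Λ ω, (Function.support f).Finite → ∀ j : Λ, T f j = ∑ᶠ k : Λ, A j k * f k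

end WeightedL2

/-! ### Schatten–von Neumann classes -/

section Schatten

variable {H₁ H₂ : Type*} [NormedAddCommGroup H₁] [InnerProductSpace ℂ H₁]
  [NormedAddCommGroup H₂] [InnerProductSpace ℂ H₂]

/-- The singular value `σ_j(T)` of order `j ≥ 1`: the distance in operator norm from `T` to the
operators of rank at most `j - 1` (that is, of rank `< j`). -/
def singularValue (T : H₁ →L[ℂ] H₂) (j : ℕ) : ℝ≥0∞ :=
  ⨅ (T₀ : H₁ →L[ℂ] H₂) (_ : (T₀ : H₁ →ₗ[ℂ] H₂).rank < (j : Cardinal)), ‖T - T₀‖ₑ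

/-- The Schatten quasi-norm `‖T‖_{I_p} = ‖(σ_j(T))_{j ≥ 1}‖_{ℓ^p}`. -/
def schattenNorm (p : ℝ≥0∞) (T : H₁ →L[ℂ] H₂) : ℝ≥0∞ :=
  ellNorm p fun j : ℕ => singularValue T (j + 1)

variable (H₁ H₂) in
/-- The Schatten–von Neumann class `I_p(H₁, H₂)`. -/
def schattenClass (p : ℝ≥0∞) : Set (H₁ →L[ℂ] H₂) :=
  {T | schattenNorm p T < ∞}

end Schatten

end MatrixSchatten

end

open MatrixSchatten

/-! The vectors `e_k = ω₁(k)⁻¹ δ_k` form a Hilbert basis of the source, and the column `A e_k` has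
target norm `(∑_j |a(j,k) ω₂(j)/ω₁(k)|²)^{1/2}`. Since `p ≤ 2`, the `ℓ²` norm is at most the `ℓ^p`
quasi-norm, so the weight condition gives `∑_k ‖A e_k‖^p ≤ ‖A‖^p` in `𝕌^p`
(`tsum_enorm_column_rpow_le`). In particular the columns are square summable and define a
Hilbert–Schmidt operator.

It remains to see that `∑_j σ_j(T)^p ≤ ∑_k ‖T e_k‖^p` for `p ≤ 2` (`tsum_singularValue_rpow_le`). In
finite dimension, diagonalise `R*R` with eigenvalues `λ_i` and eigenvectors `f_i`. Then `‖R e_k‖²`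
is an average of the `λ_i` with weights `|⟨f_i, e_k⟩|²`, and Jensen's inequality for the concave
function `t^{p/2}` applies. The general case follows by keeping finitely many columns, since each
`σ_j` is 1-Lipschitz in the operator norm. -/

namespace MatrixSchatten

/-! ### Singular values of operators through a finite dimensional space. -/

section FiniteDimensional

variable {H₁ H₂ E : Type*} [NormedAddCommGroup H₁] [InnerProductSpace ℂ H₁]
  [NormedAddCommGroup H₂] [InnerProductSpace ℂ H₂]
  [NormedAddCommGroup E] [InnerProductSpace ℂ E] [FiniteDimensional ℂ E]

/-- A bounded operator on a finite dimensional space has an orthonormal basis of right singular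
vectors, listed so that the singular values decrease. -/
theorem exists_orthonormalBasis_norm_sq_apply [CompleteSpace H₂] (R : E →L[ℂ] H₂) {n : ℕ}
    (hn : Module.finrank ℂ E = n) :
    ∃ (f : OrthonormalBasis (Fin n) ℂ E) (lam : Fin n → ℝ), Antitone lam ∧ (∀ i, 0 ≤ lam i) ∧
      ∀ x, ‖R x‖ ^ 2 = ∑ i, lam i * ‖inner ℂ (f i) x‖ ^ 2 := by
  have : CompleteSpace E := FiniteDimensional.complete ℂ E
  let S : E →ₗ[ℂ] E := ((ContinuousLinearMap.adjoint R ∘L R : E →L[ℂ] E) : E →ₗ[ℂ] E)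
  have hSapp : ∀ x, S x = ContinuousLinearMap.adjoint R (R x) := fun x => rfl
  have hS : S.IsSymmetric := by
    intro x y
    rw [hSapp, hSapp, ContinuousLinearMap.adjoint_inner_left,
      ContinuousLinearMap.adjoint_inner_right]
  have hq : ∀ x, inner ℂ x (S x) = (‖R x‖ ^ 2 : ℝ) := by
    intro x
    rw [hSapp, ContinuousLinearMap.adjoint_inner_right, inner_self_eq_norm_sq_to_K]
    norm_cast
  refine ⟨hS.eigenvectorBasis hn, hS.eigenvalues hn, hS.eigenvalues_antitone hn, ?_, ?_⟩
  · intro i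
    have h := hq (hS.eigenvectorBasis hn i)
    rw [hS.apply_eigenvectorBasis, inner_smul_right, inner_self_eq_norm_sq_to_K,
      (hS.eigenvectorBasis hn).norm_eq_one] at h
    have h' : hS.eigenvalues hn i = ‖R (hS.eigenvectorBasis hn i)‖ ^ 2 := by
      have := congrArg Complex.re h
      simpa [← Complex.ofReal_pow] using this
    rw [h']
    positivity
  · intro x
    have h := hq x
    rw [← (hS.eigenvectorBasis hn).sum_inner_mul_inner x (S x)] at h
    apply Complex.ofReal_injective
    rw [← h]
    push_cast
    refine Finset.sum_congr rfl fun i _ => ?_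
    rw [← hS, hS.apply_eigenvectorBasis, inner_smul_left, ← inner_conj_symm x]
    rw [mul_left_comm, ← Complex.normSq_eq_conj_mul_self, Complex.normSq_eq_norm_sq]
    simp

theorem singularValue_le_of_rank_lt (T T₀ : H₁ →L[ℂ] H₂) {j : ℕ}
    (h : (T₀ : H₁ →ₗ[ℂ] H₂).rank < (j : Cardinal)) : singularValue T j ≤ ‖T - T₀‖ₑ :=
  iInf₂_le T₀ h

theorem rank_comp_lt (R : E →L[ℂ] H₂) (Q : H₁ →L[ℂ] E) {n : ℕ}
    (hn : Module.finrank ℂ E ≤ n) :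
    ((R ∘L Q : H₁ →L[ℂ] H₂) : H₁ →ₗ[ℂ] H₂).rank < ((n + 1 : ℕ) : Cardinal) := by
  have hle : LinearMap.range ((R ∘L Q : H₁ →L[ℂ] H₂) : H₁ →ₗ[ℂ] H₂) ≤
      LinearMap.range (R : E →ₗ[ℂ] H₂) :=
    LinearMap.range_comp_le_range (Q : H₁ →ₗ[ℂ] E) (R : E →ₗ[ℂ] H₂)
  have h1 := (Submodule.finrank_mono hle).trans ((LinearMap.finrank_range_le _).trans hn)
  have := Submodule.finiteDimensional_of_le hle
  rw [LinearMap.rank, ← Module.finrank_eq_rank]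
  exact_mod_cast Nat.lt_succ_of_le h1

theorem singularValue_comp_eq_zero (R : E →L[ℂ] H₂) (Q : H₁ →L[ℂ] E) {j : ℕ}
    (hj : Module.finrank ℂ E ≤ j) : singularValue (R ∘L Q) (j + 1) = 0 := by
  refine le_antisymm ?_ zero_le
  refine (singularValue_le_of_rank_lt (R ∘L Q) (R ∘L Q)
    (rank_comp_lt R Q hj)).trans ?_
  rw [sub_self, ← ofReal_norm, norm_zero, ENNReal.ofReal_zero]

-- The competitor replaces `Q x` by its projection `V (U x)` onto the span of the first `j`
-- eigenvectors. It has rank at most `j`, and on the remainder only eigenvalues `lam i ≤ lam j` act.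
-- Indices in `Fin n` start at 0, hence the order `j + 1`.
omit [FiniteDimensional ℂ E] in
theorem singularValue_comp_le (R : E →L[ℂ] H₂) (Q : H₁ →L[ℂ] E) (hQ : ‖Q‖ ≤ 1) {n : ℕ}
    (f : OrthonormalBasis (Fin n) ℂ E) (lam : Fin n → ℝ) (hanti : Antitone lam)
    (h0 : ∀ i, 0 ≤ lam i) (hR : ∀ x, ‖R x‖ ^ 2 = ∑ i, lam i * ‖inner ℂ (f i) x‖ ^ 2)
    (j : Fin n) : singularValue (R ∘L Q) (j + 1) ≤ ENNReal.ofReal (√(lam j)) := by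
  let U : H₁ →L[ℂ] EuclideanSpace ℂ (Fin j) :=
    (EuclideanSpace.equiv (Fin j) ℂ).symm.toContinuousLinearMap ∘L
      (ContinuousLinearMap.pi fun i : Fin j => innerSL ℂ (f (i.castLE j.2.le))) ∘L Q
  let V : EuclideanSpace ℂ (Fin j) →L[ℂ] E :=
    ∑ i : Fin j, (EuclideanSpace.proj i : EuclideanSpace ℂ (Fin j) →L[ℂ] ℂ).smulRight
      (f (i.castLE j.2.le))
  have hVU : ∀ x, V (U x) =
      ∑ i : Fin j, inner ℂ (f (i.castLE j.2.le)) (Q x) • f (i.castLE j.2.le) := by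
    intro x
    simp [V, U]
  have hin : ∀ (x : H₁) (i : Fin n), inner ℂ (f i) (Q x - V (U x)) =
      if i < j then 0 else inner ℂ (f i) (Q x) := by
    intro x i
    rw [inner_sub_right, hVU, inner_sum]
    simp_rw [inner_smul_right, orthonormal_iff_ite.1 f.orthonormal]
    split_ifs with hij
    · rw [Finset.sum_eq_single (⟨i, hij⟩ : Fin j)]
      · simp
      · intro b _ hb
        have : i ≠ b.castLE j.2.le := by
          rintro h
          exact hb (by ext; simp [h])
        simp [this]
      · simp
    · rw [Finset.sum_eq_zero, sub_zero]
      intro b _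
      have : i ≠ b.castLE j.2.le := by
        rintro rfl
        exact hij b.2
      simp [this]
  refine (singularValue_le_of_rank_lt _ ((R ∘L V) ∘L U)
    (rank_comp_lt (R ∘L V) U (by simp))).trans ?_
  rw [← ofReal_norm]
  refine ENNReal.ofReal_le_ofReal (ContinuousLinearMap.opNorm_le_bound _ (Real.sqrt_nonneg _) ?_)
  intro x
  have hx : ((R ∘L Q) - (R ∘L V) ∘L U) x = R (Q x - V (U x)) := by simp
  rw [hx]
  refine le_of_sq_le_sq ?_ (by positivity)
  rw [hR, mul_pow, Real.sq_sqrt (h0 j)]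
  calc ∑ i, lam i * ‖inner ℂ (f i) (Q x - V (U x))‖ ^ 2
      ≤ ∑ i, lam j * ‖inner ℂ (f i) (Q x)‖ ^ 2 := by
        refine Finset.sum_le_sum fun i _ => ?_
        rw [hin]
        split_ifs with hij
        · simpa using mul_nonneg (h0 j) (by positivity)
        · exact mul_le_mul_of_nonneg_right (hanti (not_lt.1 hij)) (by positivity)
    _ = lam j * ‖Q x‖ ^ 2 := by rw [← Finset.mul_sum, f.sum_sq_norm_inner_right]
    _ ≤ lam j * ‖x‖ ^ 2 := by
        have : ‖Q x‖ ≤ ‖x‖ := (Q.le_of_opNorm_le hQ x).trans (one_mul _).le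
        have := h0 j
        gcongr

-- The matrix `‖⟨f_i, e_k⟩‖²` is doubly stochastic: sums over `i` equal to 1 permit Jensen's
-- inequality for each `k`, and sums over `k` equal to 1 recover the left side.
omit [FiniteDimensional ℂ E] in
theorem sum_rpow_le_sum_norm_rpow {κ : Type*} [Fintype κ] (R : E →L[ℂ] H₂) {n : ℕ}
    (f : OrthonormalBasis (Fin n) ℂ E) (e : OrthonormalBasis κ ℂ E) (lam : Fin n → ℝ)
    (h0 : ∀ i, 0 ≤ lam i) (hR : ∀ x, ‖R x‖ ^ 2 = ∑ i, lam i * ‖inner ℂ (f i) x‖ ^ 2)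
    {p : ℝ} (hp0 : 0 < p) (hp2 : p ≤ 2) :
    ∑ i, √(lam i) ^ p ≤ ∑ k, ‖R (e k)‖ ^ p := by
  have hs : ∀ t : ℝ, 0 ≤ t → √t ^ p = t ^ (p / 2) := by
    intro t ht
    rw [Real.sqrt_eq_rpow, ← Real.rpow_mul ht]
    ring_nf
  have key : ∀ k, ∑ i, ‖inner ℂ (f i) (e k)‖ ^ 2 * lam i ^ (p / 2) ≤ ‖R (e k)‖ ^ p := by
    intro k
    have h1 : ∑ i, ‖inner ℂ (f i) (e k)‖ ^ 2 = 1 := by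
      rw [f.sum_sq_norm_inner_right, e.norm_eq_one, one_pow]
    have h := (Real.concaveOn_rpow (p := p / 2) (by positivity) (by linarith)).le_map_sum
      (t := Finset.univ) (w := fun i => ‖inner ℂ (f i) (e k)‖ ^ 2) (p := lam)
      (fun i _ => by positivity) h1 (fun i _ => h0 i)
    simp only [smul_eq_mul] at h
    refine h.trans_eq ?_
    have : ∑ i, ‖inner ℂ (f i) (e k)‖ ^ 2 * lam i = ‖R (e k)‖ ^ 2 := by
      rw [hR]
      exact Finset.sum_congr rfl fun i _ => mul_comm _ _
    rw [this, ← hs _ (by positivity), Real.sqrt_sq (norm_nonneg _)]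
  calc ∑ i, √(lam i) ^ p = ∑ i, ∑ k, ‖inner ℂ (f i) (e k)‖ ^ 2 * lam i ^ (p / 2) := by
        refine Finset.sum_congr rfl fun i _ => ?_
        rw [← Finset.sum_mul, e.sum_sq_norm_inner_left, f.norm_eq_one, one_pow, one_mul,
          hs _ (h0 i)]
    _ = ∑ k, ∑ i, ‖inner ℂ (f i) (e k)‖ ^ 2 * lam i ^ (p / 2) := Finset.sum_comm
    _ ≤ ∑ k, ‖R (e k)‖ ^ p := Finset.sum_le_sum fun k _ => key k

/-- For `p ≤ 2`, the Schatten quasi-norm of an operator factoring through a finite dimensional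
space is at most the `ℓ^p` quasi-norm of the norms of its columns. -/
theorem tsum_singularValue_comp_rpow_le [CompleteSpace H₂] {κ : Type*} [Fintype κ]
    (R : E →L[ℂ] H₂) (Q : H₁ →L[ℂ] E) (hQ : ‖Q‖ ≤ 1) (e : OrthonormalBasis κ ℂ E)
    {p : ℝ} (hp0 : 0 < p) (hp2 : p ≤ 2) :
    ∑' j : ℕ, singularValue (R ∘L Q) (j + 1) ^ p ≤ ∑ k, ‖R (e k)‖ₑ ^ p := by
  obtain ⟨f, lam, hanti, h0, hR⟩ := exists_orthonormalBasis_norm_sq_apply R rfl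
  rw [tsum_eq_sum (s := Finset.range (Module.finrank ℂ E)), Finset.sum_range]
  · calc ∑ j : Fin (Module.finrank ℂ E), singularValue (R ∘L Q) (j + 1) ^ p
        ≤ ∑ j, ENNReal.ofReal (√(lam j) ^ p) := by
          refine Finset.sum_le_sum fun j _ => ?_
          rw [← ENNReal.ofReal_rpow_of_nonneg (Real.sqrt_nonneg _) hp0.le]
          exact ENNReal.rpow_le_rpow (singularValue_comp_le R Q hQ f lam hanti h0 hR j) hp0.le
      _ = ENNReal.ofReal (∑ j, √(lam j) ^ p) :=
          (ENNReal.ofReal_sum_of_nonneg fun i _ => by positivity).symm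
      _ ≤ ENNReal.ofReal (∑ k, ‖R (e k)‖ ^ p) :=
          ENNReal.ofReal_le_ofReal (sum_rpow_le_sum_norm_rpow R f e lam h0 hR hp0 hp2)
      _ = ∑ k, ‖R (e k)‖ₑ ^ p := by
          rw [ENNReal.ofReal_sum_of_nonneg fun i _ => by positivity]
          refine Finset.sum_congr rfl fun k _ => ?_
          rw [← ENNReal.ofReal_rpow_of_nonneg (norm_nonneg _) hp0.le, ofReal_norm]
  · intro j hj
    rw [singularValue_comp_eq_zero R Q (by simpa using hj), ENNReal.zero_rpow_of_pos hp0]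

end FiniteDimensional

/-! ### Operators with square summable columns. -/

section Columns

variable {ι H₁ H₂ : Type*} [NormedAddCommGroup H₁] [InnerProductSpace ℂ H₁]
  [NormedAddCommGroup H₂] [InnerProductSpace ℂ H₂]

theorem ext_hilbertBasis (b : HilbertBasis ι ℂ H₁) {T T' : H₁ →L[ℂ] H₂}
    (h : ∀ k, T (b k) = T' (b k)) : T = T' := by
  refine ContinuousLinearMap.ext_on (s := Set.range b) ?_ ?_
  · rw [Submodule.dense_iff_topologicalClosure_eq_top]
    exact b.dense_span
  · rintro _ ⟨k, rfl⟩
    exact h k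

theorem hasSum_norm_repr_sq (b : HilbertBasis ι ℂ H₁) (x : H₁) :
    HasSum (fun k => ‖b.repr x k‖ ^ 2) (‖x‖ ^ 2) := by
  have h := lp.hasSum_norm (E := fun _ : ι => ℂ) (p := 2) (by norm_num) (b.repr x)
  rw [b.repr.norm_map] at h
  simpa using h

theorem summable_norm_repr_smul (b : HilbertBasis ι ℂ H₁) {c : ι → H₂}
    (hc : Summable fun k => ‖c k‖ ^ 2) (x : H₁) :
    (Summable fun k => ‖b.repr x k • c k‖) ∧
      ∑' k, ‖b.repr x k • c k‖ ≤ √(∑' k, ‖c k‖ ^ 2) * ‖x‖ := by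
  have hx := hasSum_norm_repr_sq b x
  have h := Real.summable_and_inner_le_Lp_mul_Lq_tsum_of_nonneg Real.HolderConjugate.two_two
    (fun k => norm_nonneg (b.repr x k)) (fun k => norm_nonneg (c k))
    (by simpa using hx.summable) (by simpa using hc)
  simp only [Real.rpow_two, ← Real.sqrt_eq_rpow, hx.tsum_eq, ← norm_smul] at h
  rwa [Real.sqrt_sq (norm_nonneg x), mul_comm] at h

/-- Square summable columns define a bounded (Hilbert–Schmidt) operator. -/
theorem exists_clm_of_columns [CompleteSpace H₂] (b : HilbertBasis ι ℂ H₁) {c : ι → H₂}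
    (hc : Summable fun k => ‖c k‖ ^ 2) :
    ∃ T : H₁ →L[ℂ] H₂, (∀ k, T (b k) = c k) ∧ ‖T‖ ≤ √(∑' k, ‖c k‖ ^ 2) := by
  classical
  have hs : ∀ x, Summable fun k => b.repr x k • c k :=
    fun x => (summable_norm_repr_smul b hc x).1.of_norm
  let L : H₁ →ₗ[ℂ] H₂ :=
    { toFun := fun x => ∑' k, b.repr x k • c k
      map_add' := fun x y => by
        rw [← (hs x).tsum_add (hs y)]
        simp [add_smul]
      map_smul' := fun a x => by
        rw [RingHom.id_apply, ← (hs x).tsum_const_smul]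
        simp [smul_smul] }
  refine ⟨L.mkContinuous (√(∑' k, ‖c k‖ ^ 2)) fun x => ?_, fun k => ?_,
    L.mkContinuous_norm_le (Real.sqrt_nonneg _) _⟩
  · obtain ⟨h1, h2⟩ := summable_norm_repr_smul b hc x
    exact (norm_tsum_le_tsum_norm h1).trans h2
  · change ∑' l, b.repr (b k) l • c l = c k
    rw [tsum_eq_single k]
    · simp [b.repr_self]
    · intro l hl
      simp [b.repr_self, hl]

/-- Any competitor for `T'` also competes for `T`, at an extra cost `‖T - T'‖`. -/
theorem singularValue_le_add (T T' : H₁ →L[ℂ] H₂) (j : ℕ) :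
    singularValue T j ≤ singularValue T' j + ‖T - T'‖ₑ := by
  simp only [singularValue, ENNReal.iInf_add]
  refine le_iInf₂ fun T₀ h => (iInf₂_le T₀ h).trans ?_
  rw [← sub_add_sub_cancel T T' T₀, add_comm]
  simp only [← ofReal_norm]
  rw [← ENNReal.ofReal_add (norm_nonneg _) (norm_nonneg _)]
  exact ENNReal.ofReal_le_ofReal (norm_add_le _ _)

/-- An operator with square summable columns is approximated by its restriction to finitely many
columns, whose Schatten quasi-norm is controlled. -/
theorem exists_truncation [CompleteSpace H₂] (b : HilbertBasis ι ℂ H₁) (T : H₁ →L[ℂ] H₂)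
    (hT : Summable fun k => ‖T (b k)‖ ^ 2) {p : ℝ} (hp0 : 0 < p) (hp2 : p ≤ 2) (s : Finset ι) :
    ∃ T' : H₁ →L[ℂ] H₂, ‖T - T'‖ ≤ √(∑' k : {k // k ∉ s}, ‖T (b k)‖ ^ 2) ∧
      ∑' j : ℕ, singularValue T' (j + 1) ^ p ≤ ∑ k ∈ s, ‖T (b k)‖ₑ ^ p := by
  classical
  let R : EuclideanSpace ℂ s →L[ℂ] H₂ :=
    ∑ k : s, (EuclideanSpace.proj k : EuclideanSpace ℂ s →L[ℂ] ℂ).smulRight (T (b k))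
  let Q : H₁ →L[ℂ] EuclideanSpace ℂ s :=
    (EuclideanSpace.equiv s ℂ).symm.toContinuousLinearMap ∘L
      (ContinuousLinearMap.pi fun k : s => innerSL ℂ (b k))
  have hQ : ‖Q‖ ≤ 1 := by
    refine ContinuousLinearMap.opNorm_le_bound _ zero_le_one fun x => ?_
    rw [one_mul]
    refine le_of_sq_le_sq ?_ (norm_nonneg x)
    rw [EuclideanSpace.norm_sq_eq]
    have h := b.orthonormal.sum_inner_products_le (s := s) (x := x)
    rw [← Finset.sum_coe_sort] at h
    exact h
  have hR : ∀ k : s, R (EuclideanSpace.basisFun s ℂ k) = T (b k) := by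
    intro k
    simp [R]
  have hRQ : ∀ k, (R ∘L Q) (b k) = if k ∈ s then T (b k) else 0 := by
    intro k
    have : (R ∘L Q) (b k) = ∑ l : s, inner ℂ (b l) (b k) • T (b l) := by
      simp [R, Q]
    rw [this, Finset.sum_coe_sort s fun l => inner ℂ (b l) (b k) • T (b l)]
    simp [orthonormal_iff_ite.1 b.orthonormal]
  refine ⟨R ∘L Q, ?_, ?_⟩
  · have hind : ∀ k, ‖if k ∈ s then 0 else T (b k)‖ ^ 2 =
        Set.indicator {k | k ∉ s} (fun k => ‖T (b k)‖ ^ 2) k := by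
      intro k
      by_cases hk : k ∈ s <;> simp [hk]
    -- The error of truncation is the operator whose columns are those outside `s`, so its norm is
    -- at most the Hilbert–Schmidt tail.
    obtain ⟨D, hD, hDn⟩ := exists_clm_of_columns b (c := fun k => if k ∈ s then 0 else T (b k))
      (by simpa only [hind] using hT.indicator _)
    have hTD : T - R ∘L Q = D := by
      refine ext_hilbertBasis b fun k => ?_
      rw [_root_.sub_apply, hRQ, hD]
      split_ifs <;> simp
    rw [hTD]
    simp only [hind] at hDn
    rwa [← tsum_subtype] at hDn
  · refine (tsum_singularValue_comp_rpow_le R Q hQ (EuclideanSpace.basisFun s ℂ) hp0 hp2).trans ?_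
    simp only [hR]
    rw [Finset.sum_coe_sort s fun k => ‖T (b k)‖ₑ ^ p]

/-- For `p ≤ 2`, the Schatten quasi-norm of a Hilbert–Schmidt operator is at most the `ℓ^p`
quasi-norm of the norms of its columns in any Hilbert basis. -/
theorem tsum_singularValue_rpow_le [CompleteSpace H₂] (b : HilbertBasis ι ℂ H₁) (T : H₁ →L[ℂ] H₂)
    (hT : Summable fun k => ‖T (b k)‖ ^ 2) {p : ℝ} (hp0 : 0 < p) (hp2 : p ≤ 2) :
    ∑' j : ℕ, singularValue T (j + 1) ^ p ≤ ∑' k, ‖T (b k)‖ₑ ^ p := by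
  choose T' hT' hsum using exists_truncation b T hT hp0 hp2
  have hε : Filter.Tendsto
      (fun s : Finset ι => ENNReal.ofReal (√(∑' k : {k // k ∉ s}, ‖T (b k)‖ ^ 2)))
      Filter.atTop (nhds 0) := by
    have h := (Real.continuous_sqrt.tendsto 0).comp
      (tendsto_tsum_compl_atTop_zero fun k => ‖T (b k)‖ ^ 2)
    simpa using ENNReal.tendsto_ofReal h
  -- Only finitely many singular values are compared at a time, so the limit over `s` is taken in a
  -- finite sum.
  rw [ENNReal.tsum_eq_iSup_sum]
  refine iSup_le fun J => ?_
  have hlim : Filter.Tendsto (fun s : Finset ι => ∑ j ∈ J, (singularValue T (j + 1) -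
      ENNReal.ofReal (√(∑' k : {k // k ∉ s}, ‖T (b k)‖ ^ 2))) ^ p)
      Filter.atTop (nhds (∑ j ∈ J, singularValue T (j + 1) ^ p)) := by
    refine tendsto_finsetSum _ fun j _ => ?_
    have h := ENNReal.Tendsto.sub (tendsto_const_nhds (x := singularValue T (j + 1))) hε
      (Or.inr ENNReal.zero_ne_top)
    rw [tsub_zero] at h
    exact (ENNReal.continuous_rpow_const.tendsto _).comp h
  refine le_of_tendsto' hlim fun s => ?_
  calc _ ≤ ∑ j ∈ J, singularValue (T' s) (j + 1) ^ p := by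
        refine Finset.sum_le_sum fun j _ => ENNReal.rpow_le_rpow ?_ hp0.le
        rw [tsub_le_iff_right]
        refine (singularValue_le_add T (T' s) (j + 1)).trans ?_
        gcongr
        rw [← ofReal_norm]
        exact ENNReal.ofReal_le_ofReal (hT' s)
    _ ≤ ∑' j : ℕ, singularValue (T' s) (j + 1) ^ p := ENNReal.sum_le_tsum J
    _ ≤ ∑ k ∈ s, ‖T (b k)‖ₑ ^ p := hsum s
    _ ≤ ∑' k, ‖T (b k)‖ₑ ^ p := ENNReal.sum_le_tsum s

end Columns

/-! ### Comparison of `ℓ^q` and `ℓ²`, and the matrix quasi-norm. -/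

section SequenceNorms

/-- Subadditivity of `t ↦ t^r` on finite sums, then a limit. -/
theorem rpow_tsum_le_tsum_rpow {ι : Type*} (f : ι → ℝ≥0∞) {r : ℝ} (h0 : 0 < r) (h1 : r ≤ 1) :
    (∑' i, f i) ^ r ≤ ∑' i, f i ^ r := by
  classical
  have hfin : ∀ s : Finset ι, (∑ i ∈ s, f i) ^ r ≤ ∑ i ∈ s, f i ^ r := by
    intro s
    induction s using Finset.induction_on with
    | empty => simp [h0]
    | insert a s ha ih =>
      rw [Finset.sum_insert ha, Finset.sum_insert ha]
      exact (ENNReal.rpow_add_le_add_rpow _ _ h0.le h1).trans (add_le_add le_rfl ih)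
  refine le_of_tendsto' ((ENNReal.continuous_rpow_const.tendsto _).comp
    (ENNReal.summable (f := f)).hasSum) fun s => ?_
  exact (hfin s).trans (ENNReal.sum_le_tsum s)

theorem tsum_sq_rpow_le {ι : Type*} (f : ι → ℝ≥0∞) {q : ℝ} (h0 : 0 < q) (h2 : q ≤ 2) :
    (∑' i, f i ^ 2) ^ (q / 2) ≤ ∑' i, f i ^ q := by
  refine (rpow_tsum_le_tsum_rpow _ (by positivity) (by linarith)).trans_eq ?_
  refine tsum_congr fun i => ?_
  rw [← ENNReal.rpow_two, ← ENNReal.rpow_mul]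
  congr 1
  ring

theorem summable_norm_sq_of_tsum_rpow_ne_top {ι E : Type*} [SeminormedAddCommGroup E] (y : ι → E)
    {q : ℝ} (h0 : 0 < q) (h2 : q ≤ 2) (h : ∑' i, ‖y i‖ₑ ^ q ≠ ∞) :
    Summable fun i => ‖y i‖ ^ 2 := by
  have hy : ∑' i, ‖y i‖ₑ ^ 2 ≠ ∞ := by
    intro htop
    have := tsum_sq_rpow_le (fun i => ‖y i‖ₑ) h0 h2
    rw [htop, ENNReal.top_rpow_of_pos (by positivity), top_le_iff] at this
    exact h this
  simpa using ENNReal.summable_toReal hy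

theorem enorm_lp_two_rpow_le {ι : Type*} (g : lp (fun _ : ι => ℂ) 2) {q : ℝ} (h0 : 0 < q)
    (h2 : q ≤ 2) : ‖g‖ₑ ^ q ≤ ∑' i, ‖g i‖ₑ ^ q := by
  refine le_trans (le_of_eq ?_) (tsum_sq_rpow_le (fun i => ‖g i‖ₑ) h0 h2)
  have hg : HasSum (fun i => ‖g i‖ ^ 2) (‖g‖ ^ 2) := by
    simpa using lp.hasSum_norm (E := fun _ : ι => ℂ) (p := 2) (by norm_num) g
  have : ∑' i, ‖g i‖ₑ ^ 2 = ‖g‖ₑ ^ 2 := by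
    simp only [← ofReal_norm, ← ENNReal.ofReal_pow (norm_nonneg _)]
    rw [← hg.tsum_eq, ENNReal.ofReal_tsum_of_nonneg (fun i => by positivity) hg.summable]
  rw [this, ← ENNReal.rpow_two, ← ENNReal.rpow_mul]
  congr 1
  ring

/-- With equal exponents the order of summation is immaterial, and for each fixed `j` the map `k ↦ j
- k` permutes `G`, so the shear disappears. -/
theorem matrixNorm_self_eq {G : Type*} [AddCommGroup G] (ω : G → G → ℝ) (A : Matrix G G ℂ)
    {p : ℝ≥0∞} (hp0 : p ≠ 0) (hp : p ≠ ∞) :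
    matrixNorm p p ω A =
      (∑' k, ∑' j, ‖A j k * (ω j k : ℂ)‖ₑ ^ p.toReal) ^ (1 / p.toReal) := by
  have hp' : p.toReal ≠ 0 := (ENNReal.toReal_pos hp0 hp).ne'
  simp only [matrixNorm, smallH, ellNorm, hp, if_false, bigH]
  congr 1
  simp only [← ENNReal.rpow_mul, one_div, inv_mul_cancel₀ hp', ENNReal.rpow_one]
  rw [ENNReal.tsum_comm, ENNReal.tsum_comm (f := fun k j => ‖A j k * (ω j k : ℂ)‖ₑ ^ p.toReal)]
  refine tsum_congr fun j => ?_
  exact (Equiv.subLeft j).tsum_eq fun k => ‖A j k * (ω j k : ℂ)‖ₑ ^ p.toReal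

end SequenceNorms

/-! ### The Hilbert basis of the weighted space. -/

namespace WeightedL2

variable {d : ℕ} (Λ : AddSubgroup (Euc d)) (ω : Weight (Euc d))

/-- The Hilbert basis `k ↦ ω(k)⁻¹ δ_k` of `ℓ²_{(ω)}(Λ)`. -/
noncomputable def hilbertBasis : HilbertBasis Λ ℂ (WeightedL2 Λ ω) :=
  .ofRepr
    { LinearEquiv.ofBijective (toL2 Λ ω) ⟨toL2_injective Λ ω, toL2_surjective Λ ω⟩ with
      norm_map' := fun _ => rfl }

/-- Evaluation of a sequence at a lattice point. -/
def eval (j : Λ) : WeightedL2 Λ ω →ₗ[ℂ] ℂ :=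
  LinearMap.proj j ∘ₗ (weightedL2Submodule Λ ω).subtype

variable {Λ ω}

theorem eval_apply (j : Λ) (f : WeightedL2 Λ ω) : eval Λ ω j f = f j := rfl

theorem hilbertBasis_repr (f : WeightedL2 Λ ω) (k : Λ) :
    (hilbertBasis Λ ω).repr f k = f k * (ω k : ℂ) := rfl

theorem hilbertBasis_apply [DecidableEq Λ] (k j : Λ) :
    hilbertBasis Λ ω k j = if j = k then (ω k : ℂ)⁻¹ else 0 := by
  have h := hilbertBasis_repr (hilbertBasis Λ ω k) j
  rw [HilbertBasis.repr_self, lp.single_apply, Pi.single_apply] at h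
  have hω : (ω j : ℂ) ≠ 0 := Complex.ofReal_ne_zero.2 (ω.pos j).ne'
  rw [eq_div_of_mul_eq hω h.symm]
  split_ifs with hjk
  · rw [hjk, one_div]
  · rw [zero_div]

theorem eq_sum_of_support_subset (f : WeightedL2 Λ ω) (s : Finset Λ)
    (hs : Function.support f ⊆ s) :
    f = ∑ k ∈ s, (f k * (ω k : ℂ)) • hilbertBasis Λ ω k := by
  refine ((hilbertBasis Λ ω).hasSum_repr f).unique (hasSum_sum_of_ne_finset_zero fun k hk => ?_)
  rw [hilbertBasis_repr, Function.notMem_support.1 fun h => hk (hs h), zero_mul, zero_smul]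

end WeightedL2

/-! ### Columns of `A` as vectors of the weighted target space. -/

variable {d : ℕ} {Λ : AddSubgroup (Euc d)} {ω₁ ω₂ : Weight (Euc d)}

/-- A bounded operator extends the matrix map of `A` if and only if its columns in the basis
`k ↦ ω₁(k)⁻¹ δ_k` are those of `A`. -/
theorem extends_iff (A : Matrix Λ Λ ℂ) (T : WeightedL2 Λ ω₁ →L[ℂ] WeightedL2 Λ ω₂) :
    Extends A T ↔ ∀ k j : Λ, T (WeightedL2.hilbertBasis Λ ω₁ k) j = A j k * (ω₁ k : ℂ)⁻¹ := by
  classical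
  constructor
  · intro h k j
    have hsupp : Function.support (WeightedL2.hilbertBasis Λ ω₁ k) ⊆ {k} := by
      intro l hl
      by_contra hlk
      exact hl ((WeightedL2.hilbertBasis_apply k l).trans (if_neg hlk))
    rw [h _ ((Set.finite_singleton k).subset hsupp) j, finsum_eq_single _ k]
    · rw [WeightedL2.hilbertBasis_apply, if_pos rfl]
    · intro l hl
      rw [WeightedL2.hilbertBasis_apply, if_neg hl, mul_zero]
  · intro h f hf j
    have hTf := congrArg (fun g => WeightedL2.eval Λ ω₂ j (T g))
      (WeightedL2.eq_sum_of_support_subset f hf.toFinset (by simp))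
    simp only [map_sum, map_smul, WeightedL2.eval_apply, h] at hTf
    rw [hTf, finsum_eq_sum_of_support_subset (s := hf.toFinset)]
    · refine Finset.sum_congr rfl fun k _ => ?_
      have hω : (ω₁ k : ℂ) ≠ 0 := Complex.ofReal_ne_zero.2 (ω₁.pos k).ne'
      rw [smul_eq_mul]
      field_simp
    · intro k hk
      have : f k ≠ 0 := right_ne_zero_of_mul hk
      simpa using this

theorem Extends.unique {A : Matrix Λ Λ ℂ} {T T' : WeightedL2 Λ ω₁ →L[ℂ] WeightedL2 Λ ω₂}
    (hT : Extends A T) (hT' : Extends A T') : T = T' := by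
  refine ext_hilbertBasis (WeightedL2.hilbertBasis Λ ω₁) fun k => Subtype.ext (funext fun j => ?_)
  exact ((extends_iff A T).1 hT k j).trans ((extends_iff A T').1 hT' k j).symm

/-- The factor `ω₁(k)⁻¹` normalises the basis vector and `ω₂(j)` comes from the target norm; the
weight condition bounds their product. -/
theorem enorm_column_entry_le {ω₀ : Λ → Λ → ℝ} (hω : ∀ j k : Λ, ω₂ j / ω₁ k ≤ ω₀ j k)
    (A : Matrix Λ Λ ℂ) (j k : Λ) :
    ‖A j k * (ω₁ k : ℂ)⁻¹ * (ω₂ j : ℂ)‖ₑ ≤ ‖A j k * (ω₀ j k : ℂ)‖ₑ := by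
  have h0 : 0 < ω₂ j / ω₁ k := div_pos (ω₂.pos j) (ω₁.pos k)
  rw [← ofReal_norm, ← ofReal_norm]
  refine ENNReal.ofReal_le_ofReal ?_
  have : A j k * (ω₁ k : ℂ)⁻¹ * (ω₂ j : ℂ) = A j k * ((ω₂ j / ω₁ k : ℝ) : ℂ) := by
    push_cast
    ring
  rw [this, norm_mul, norm_mul, Complex.norm_real, Complex.norm_real, Real.norm_of_nonneg h0.le,
    Real.norm_of_nonneg (h0.le.trans (hω j k))]
  exact mul_le_mul_of_nonneg_left (hω j k) (norm_nonneg _)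

theorem WeightedL2.enorm_rpow_le (f : WeightedL2 Λ ω₂) {q : ℝ} (h0 : 0 < q) (h2 : q ≤ 2) :
    ‖f‖ₑ ^ q ≤ ∑' j : Λ, ‖f j * (ω₂ j : ℂ)‖ₑ ^ q :=
  enorm_lp_two_rpow_le (WeightedL2.toL2 Λ ω₂ f) h0 h2

theorem tsum_enorm_column_rpow_le {ω₀ : Λ → Λ → ℝ}
    (hω : ∀ j k : Λ, ω₂ j / ω₁ k ≤ ω₀ j k) {A : Matrix Λ Λ ℂ} {c : Λ → WeightedL2 Λ ω₂}
    (hc : ∀ k j, c k j = A j k * (ω₁ k : ℂ)⁻¹) {q : ℝ} (h0 : 0 < q) (h2 : q ≤ 2) :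
    ∑' k, ‖c k‖ₑ ^ q ≤ ∑' k, ∑' j, ‖A j k * (ω₀ j k : ℂ)‖ₑ ^ q := by
  refine ENNReal.tsum_le_tsum fun k => (WeightedL2.enorm_rpow_le (c k) h0 h2).trans ?_
  refine ENNReal.tsum_le_tsum fun j => ENNReal.rpow_le_rpow ?_ h0.le
  rw [hc]
  exact enorm_column_entry_le hω A j k

theorem exists_columns {ω₀ : Λ → Λ → ℝ} (hω : ∀ j k : Λ, ω₂ j / ω₁ k ≤ ω₀ j k)
    {A : Matrix Λ Λ ℂ} {q : ℝ} (h0 : 0 < q) (h2 : q ≤ 2)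
    (hA : ∑' k, ∑' j, ‖A j k * (ω₀ j k : ℂ)‖ₑ ^ q ≠ ∞) :
    ∃ c : Λ → WeightedL2 Λ ω₂, ∀ k j, c k j = A j k * (ω₁ k : ℂ)⁻¹ := by
  refine ⟨fun k => ⟨fun j => A j k * (ω₁ k : ℂ)⁻¹, ?_⟩, fun k j => rfl⟩
  have hk : ∑' j, ‖A j k * (ω₁ k : ℂ)⁻¹ * (ω₂ j : ℂ)‖ₑ ^ q ≠ ∞ := by
    refine ne_top_of_le_ne_top (ENNReal.ne_top_of_tsum_ne_top hA k) ?_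
    exact ENNReal.tsum_le_tsum fun j =>
      ENNReal.rpow_le_rpow (enorm_column_entry_le hω A j k) h0.le
  refine memℓp_gen ?_
  simpa using summable_norm_sq_of_tsum_rpow_ne_top _ h0 h2 hk

end MatrixSchatten

theorem theorem2p5 {d : ℕ} (θ : Fin d → ℝ) (hθ : ∀ i, θ i ≠ 0)
    (ω₁ ω₂ : Weight (Euc d)) (ω₀ : Weight (Euc d × Euc d))
    (hω : ∀ j k : lattice θ, ω₂ j / ω₁ k ≤ ω₀ ((j : Euc d), (k : Euc d)))
    (p : ℝ≥0∞) (hp0 : 0 < p) (hp2 : p ≤ 2)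
    (A : Matrix (lattice θ) (lattice θ) ℂ)
    (hA : A ∈ matrixClass p p fun j k : lattice θ => ω₀ ((j : Euc d), (k : Euc d))) :
    (∃! T : WeightedL2 (lattice θ) ω₁ →L[ℂ] WeightedL2 (lattice θ) ω₂, Extends A T) ∧
    ∀ T : WeightedL2 (lattice θ) ω₁ →L[ℂ] WeightedL2 (lattice θ) ω₂, Extends A T →
      T ∈ schattenClass (WeightedL2 (lattice θ) ω₁) (WeightedL2 (lattice θ) ω₂) p ∧
      schattenNorm p T ≤
        matrixNorm p p (fun j k : lattice θ => ω₀ ((j : Euc d), (k : Euc d))) A := by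
  have hp : p ≠ ∞ := ne_top_of_le_ne_top (by norm_num) hp2
  have hq0 : 0 < p.toReal := ENNReal.toReal_pos hp0.ne' hp
  have hq2 : p.toReal ≤ 2 := by simpa using ENNReal.toReal_mono (by norm_num) hp2
  have hnorm := matrixNorm_self_eq
    (fun j k : lattice θ => ω₀ ((j : Euc d), (k : Euc d))) A hp0.ne' hp
  have hA' : matrixNorm p p (fun j k : lattice θ => ω₀ ((j : Euc d), (k : Euc d))) A < ∞ := hA
  have hfin : ∑' k : lattice θ, ∑' j : lattice θ,
      ‖A j k * (ω₀ ((j : Euc d), (k : Euc d)) : ℂ)‖ₑ ^ p.toReal ≠ ∞ := by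
    intro htop
    rw [hnorm, htop, ENNReal.top_rpow_of_pos (by positivity)] at hA'
    exact lt_irrefl _ hA'
  -- Stated for an arbitrary family `c`: it serves both for the columns built to prove existence and
  -- for those of a given extension `T`.
  have hcol := fun c hc => tsum_enorm_column_rpow_le (Λ := lattice θ) (ω₁ := ω₁) (ω₂ := ω₂)
    (ω₀ := fun j k => ω₀ ((j : Euc d), (k : Euc d))) hω (A := A) (c := c) hc hq0 hq2
  have hsq := fun c hc => summable_norm_sq_of_tsum_rpow_ne_top c hq0 hq2
    (ne_top_of_le_ne_top hfin (hcol c hc))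
  refine ⟨?_, fun T hT => ?_⟩
  · obtain ⟨c, hc⟩ := exists_columns (ω₁ := ω₁) (ω₂ := ω₂)
      (ω₀ := fun j k : lattice θ => ω₀ ((j : Euc d), (k : Euc d))) hω hq0 hq2 hfin
    obtain ⟨T, hT, -⟩ := exists_clm_of_columns (WeightedL2.hilbertBasis (lattice θ) ω₁) (hsq c hc)
    have hTA : Extends A T := (extends_iff A T).2 fun k j => by rw [hT, hc]
    exact ⟨T, hTA, fun T' hT' => hT'.unique hTA⟩
  · have hc := (extends_iff A T).1 hT
    have hle : schattenNorm p T ≤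
        matrixNorm p p (fun j k : lattice θ => ω₀ ((j : Euc d), (k : Euc d))) A := by
      rw [hnorm, schattenNorm, ellNorm, if_neg hp]
      refine ENNReal.rpow_le_rpow ?_ (by positivity)
      exact (tsum_singularValue_rpow_le (WeightedL2.hilbertBasis (lattice θ) ω₁) T
        (hsq _ hc) hq0 hq2).trans (hcol _ hc)
    exact ⟨hle.trans_lt hA', hle⟩
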